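/- Let $P$ be a finite-dimensional (left) Leibniz algebra over a field $F$ of arbitrary characteristic, that is, an $F$-vector space with a bilinear product satisfying $a(bc)=(ab)c+b(ac)$ for all $a,b,c\in P$. Ideals are two-sided; a minimal ideal is a nonzero ideal containing no nonzero ideal other than itself; the centraliser of a subspace $U$ is $\mathcal C_P(U)=\{x\in P : xu=ux=0 \text{ for all } u\in U\}$; $P$ is soluble if there is a chain of subalgebras $P=P_0\supseteq P_1\supseteq\dots\supseteq P_n=0$ with each $P_{i+1}$ an ideal of $P_i$ and $P_i/P_{i+1}$ abelian (i.e. with zero product). Suppose that $P$ is primitive, that is, $P$ is soluble and has a minimal ideal which equals its own centraliser, and let $C$ be the socle of $P$, i.e. the sum of its minimal ideals. Then: 1. $C$ is the unique minimal ideal of $P$, and $\mathcal C_P(C)=C$. 2. $P$ splits over $C$: there is a complement to $C$ in $P$, i.e. a subalgebra $U$ of $P$ with $U+C=P$ and $U\cap C=0$. 3. For each $c\in C$ the map $\alpha_c=1+L_c\colon x\mapsto x+cx$ is an automorphism of the algebra $P$, and any two complements $U,V$ to $C$ in $P$ are $C$-conjugate: $V=\alpha_c(U)$ for some $c\in C$.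 4. If $P$ is not a Lie algebra, then there is exactly one complement to $C$ in $P$. -/

import Mathlib

namespace LeibnizAlg

section

variable (F : Type*) {A : Type*} [Field F] [NonUnitalNonAssocRing A] [Module F A]

/-- A (left) Leibniz algebra: every left multiplication is a derivation. -/
def IsLeibniz (A : Type*) [NonUnitalNonAssocRing A] : Prop :=
  ∀ a b c : A, a * (b * c) = (a * b) * c + b * (a * c)

/-- The multiplication is a Lie bracket: it is alternating and satisfies the Jacobi identity. -/
def IsLie (A : Type*) [NonUnitalNonAssocRing A] : Prop :=
  (∀ a : A, a * a = 0) ∧ ∀ a b c : A, a * (b * c) + b * (c * a) + c * (a * b) = 0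

variable {F}

/-- A (two-sided) ideal of the algebra. -/
def IsIdeal (I : Submodule F A) : Prop :=
  ∀ a : A, ∀ x ∈ I, a * x ∈ I ∧ x * a ∈ I

/-- A minimal ideal: minimal, under inclusion, among the nonzero two-sided ideals. -/
def IsMinimalIdeal (I : Submodule F A) : Prop :=
  Minimal (fun J : Submodule F A => IsIdeal J ∧ J ≠ ⊥) I

variable (F A) in
/-- The socle: the sum of all minimal ideals. -/
def socle : Submodule F A :=
  sSup {I : Submodule F A | IsMinimalIdeal I}

variable [IsScalarTower F A A] [SMulCommClass F A A]

/-- The two-sided centraliser `{x | xU = Ux = 0}`. -/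
def centraliser (U : Submodule F A) : Submodule F A where
  carrier := {x | ∀ u ∈ U, x * u = 0 ∧ u * x = 0}
  zero_mem' := fun u _ => ⟨zero_mul u, mul_zero u⟩
  add_mem' := fun {x y} hx hy u hu => by
    simp [add_mul, mul_add, hx u hu, hy u hu]
  smul_mem' := fun r x hx u hu => by
    simp [smul_mul_assoc, mul_smul_comm, hx u hu]

variable (F A) in
/-- Solubility: there is a chain of subalgebras `A = S 0 ⊇ S 1 ⊇ ⋯ ⊇ S n = 0` in which `S (i+1)` is
a two-sided ideal of `S i` and the quotient `S i / S (i+1)` has zero multiplication. -/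
def IsSoluble : Prop :=
  ∃ (n : ℕ) (S : ℕ → NonUnitalSubalgebra F A), S 0 = ⊤ ∧ S n = ⊥ ∧
    ∀ i < n, S (i + 1) ≤ S i ∧
      (∀ a ∈ S i, ∀ x ∈ S (i + 1), a * x ∈ S (i + 1) ∧ x * a ∈ S (i + 1)) ∧
      (∀ a ∈ S i, ∀ b ∈ S i, a * b ∈ S (i + 1))

variable (F A) in
/-- A primitive algebra: soluble, with a minimal ideal that is its own centraliser. -/
def IsPrimitive : Prop :=
  IsSoluble F A ∧ ∃ C : Submodule F A, IsMinimalIdeal C ∧ centraliser C = C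

/-- A complement to `C`: a subalgebra `U` with `U + C = A` and `U ∩ C = 0`. -/
def IsComplement (C : Submodule F A) (U : NonUnitalSubalgebra F A) : Prop :=
  IsCompl U.toSubmodule C

variable (F) in
/-- The linear map `1 + L_c`, i.e. `x ↦ x + c * x`. -/
def onePlusLeft (c : A) : A →ₗ[F] A :=
  LinearMap.id + LinearMap.mulLeft F c

/-- An algebra automorphism: a bijective linear map which preserves products. -/
def IsAutomorphism (f : A →ₗ[F] A) : Prop :=
  Function.Bijective f ∧ ∀ x y : A, f (x * y) = f x * f y

/-- `U` and `V` are `C`-conjugate: `V = (1 + L_c)(U)` for some `c ∈ C`. -/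
def IsConjugate (C : Submodule F A) (U V : NonUnitalSubalgebra F A) : Prop :=
  ∃ c ∈ C, V.toSubmodule = U.toSubmodule.map (onePlusLeft F c)

end

end LeibnizAlg

namespace LeibnizAlg

section

variable {F P : Type*} [Field F] [NonUnitalNonAssocRing P] [Module F P]

theorem IsMinimalIdeal.isIdeal {C : Submodule F P} (hC : IsMinimalIdeal C) : IsIdeal C :=
  hC.prop.1

theorem IsMinimalIdeal.ne_bot {C : Submodule F P} (hC : IsMinimalIdeal C) : C ≠ ⊥ :=
  hC.prop.2

theorem IsIdeal.inf {I J : Submodule F P} (hI : IsIdeal I) (hJ : IsIdeal J) :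
    IsIdeal (I ⊓ J) := fun a x hx =>
  ⟨⟨(hI a x hx.1).1, (hJ a x hx.2).1⟩, ⟨(hI a x hx.1).2, (hJ a x hx.2).2⟩⟩

/-- The products of elements of an ideal span an ideal. -/
theorem IsIdeal.span_mul [IsScalarTower F P P] [SMulCommClass F P P] (hL : IsLeibniz P)
    {I : Submodule F P} (hI : IsIdeal I) :
    IsIdeal (Submodule.span F {z | ∃ x ∈ I, ∃ y ∈ I, x * y = z}) := by
  have key : ∀ x ∈ I, ∀ y ∈ I,
      x * y ∈ Submodule.span F {z | ∃ x ∈ I, ∃ y ∈ I, x * y = z} :=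
    fun x hx y hy => Submodule.subset_span ⟨x, hx, y, hy, rfl⟩
  intro a z hz
  induction hz using Submodule.span_induction with
  | mem z hz =>
    obtain ⟨x, hx, y, hy, rfl⟩ := hz
    constructor
    · rw [hL]
      exact add_mem (key _ (hI a x hx).1 _ hy) (key _ hx _ (hI a y hy).1)
    · rw [← sub_eq_of_eq_add (hL x y a)]
      exact sub_mem (key _ hx _ (hI a y hy).2) (key _ hy _ (hI a x hx).2)
  | zero => simp
  | add x y _ _ hx hy =>
    rw [mul_add, add_mul]
    exact ⟨add_mem hx.1 hy.1, add_mem hx.2 hy.2⟩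
  | smul r x _ hx =>
    rw [mul_smul_comm, smul_mul_assoc]
    exact ⟨Submodule.smul_mem _ _ hx.1, Submodule.smul_mem _ _ hx.2⟩

theorem mul_eq_zero_of_centraliser [IsScalarTower F P P] [SMulCommClass F P P]
    {C : Submodule F P} (hCC : centraliser C = C) {x y : P} (hx : x ∈ C) (hy : y ∈ C) :
    x * y = 0 := by
  rw [← hCC] at hx
  exact (hx y hy).1

/-- A self-centralising minimal ideal is contained in every nonzero ideal. -/
theorem IsMinimalIdeal.le_of_centraliser [IsScalarTower F P P] [SMulCommClass F P P]
    {C : Submodule F P} (hC : IsMinimalIdeal C) (hCC : centraliser C = C)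
    {I : Submodule F P} (hI : IsIdeal I) (hne : I ≠ ⊥) : C ≤ I := by
  by_cases h : I ⊓ C = ⊥
  · have hIC : I ≤ C := by
      intro x hx
      rw [← hCC]
      intro c hc
      constructor
      · have : x * c ∈ I ⊓ C := ⟨(hI c x hx).2, (hC.isIdeal x c hc).1⟩
        simpa [h] using this
      · have : c * x ∈ I ⊓ C := ⟨(hI c x hx).1, (hC.isIdeal x c hc).2⟩
        simpa [h] using this
    rw [inf_eq_left.2 hIC] at h
    exact absurd h hne
  · exact (hC.le_of_le ⟨hI.inf hC.isIdeal, h⟩ inf_le_right).trans inf_le_left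

theorem IsMinimalIdeal.iff_eq_of_centraliser [IsScalarTower F P P] [SMulCommClass F P P]
    {C : Submodule F P} (hC : IsMinimalIdeal C) (hCC : centraliser C = C)
    (I : Submodule F P) : IsMinimalIdeal I ↔ I = C := by
  refine ⟨fun hI => ?_, fun h => h ▸ hC⟩
  have hle := hC.le_of_centraliser hCC hI.isIdeal hI.ne_bot
  exact le_antisymm (hI.le_of_le ⟨hC.isIdeal, hC.ne_bot⟩ hle) hle

theorem IsMinimalIdeal.socle_eq [IsScalarTower F P P] [SMulCommClass F P P]
    {C : Submodule F P} (hC : IsMinimalIdeal C) (hCC : centraliser C = C) :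
    socle F P = C := by
  simp [socle, hC.iff_eq_of_centraliser hCC]

variable (F P) in
/-- The left annihilator `{x | xP = 0}`. -/
def leftAnnihilator [IsScalarTower F P P] : Submodule F P where
  carrier := {x | ∀ y, x * y = 0}
  zero_mem' := fun y => zero_mul y
  add_mem' := fun {x y} hx hy z => by rw [add_mul, hx z, hy z, add_zero]
  smul_mem' := fun r x hx y => by rw [smul_mul_assoc, hx y, smul_zero]

theorem isIdeal_leftAnnihilator [IsScalarTower F P P] (hL : IsLeibniz P) :
    IsIdeal (leftAnnihilator F P) := by
  intro a x hx
  refine ⟨fun b => ?_, ?_⟩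
  · have h := hL a x b
    rw [hx, hx, mul_zero, add_zero] at h
    exact h.symm
  · rw [hx a]
    exact zero_mem _

theorem sq_mem_leftAnnihilator [IsScalarTower F P P] (hL : IsLeibniz P) (a : P) :
    a * a ∈ leftAnnihilator F P := fun b => by
  simpa using hL a a b

theorem mul_eq_neg_mul (h : ∀ a : P, a * a = 0) (a b : P) : a * b = -(b * a) := by
  have := h (a + b)
  rw [add_mul, mul_add, mul_add, h, h, zero_add, add_zero] at this
  exact eq_neg_of_add_eq_zero_left this

theorem isLie_of_sq_eq_zero (hL : IsLeibniz P) (h : ∀ a : P, a * a = 0) : IsLie P := by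
  refine ⟨h, fun a b c => ?_⟩
  rw [hL a b c, mul_eq_neg_mul h c (a * b), mul_eq_neg_mul h c a, mul_neg]
  abel

/-- Either the minimal ideal annihilates the algebra from the left, or the algebra is
anticommutative. -/
theorem IsMinimalIdeal.mul_eq_zero_or_sq_eq_zero [IsScalarTower F P P] [SMulCommClass F P P]
    (hL : IsLeibniz P) {C : Submodule F P} (hC : IsMinimalIdeal C) (hCC : centraliser C = C) :
    (∀ c ∈ C, ∀ x, c * x = 0) ∨ ∀ a : P, a * a = 0 := by
  by_cases h : leftAnnihilator F P = ⊥
  · right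
    intro a
    have := sq_mem_leftAnnihilator (F := F) hL a
    simpa [h] using this
  · left
    exact fun c hc => hC.le_of_centraliser hCC (isIdeal_leftAnnihilator hL) h hc

/-- A subspace of the minimal ideal stable under left multiplications is an ideal. -/
theorem IsMinimalIdeal.isIdeal_of_mul_left_mem [IsScalarTower F P P] [SMulCommClass F P P]
    (hL : IsLeibniz P) {C : Submodule F P} (hC : IsMinimalIdeal C) (hCC : centraliser C = C)
    {W : Submodule F P} (hWC : W ≤ C) (hW : ∀ x, ∀ w ∈ W, x * w ∈ W) : IsIdeal W := by
  intro x w hw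
  refine ⟨hW x w hw, ?_⟩
  rcases hC.mul_eq_zero_or_sq_eq_zero hL hCC with h | h
  · rw [h w (hWC hw)]
    exact zero_mem _
  · rw [mul_eq_neg_mul h]
    exact neg_mem (hW x w hw)

/-- The elements of `C` killed by some power of left multiplication by `a`. -/
def fittingNull [SMulCommClass F P P] (C : Submodule F P) (a : P) : Submodule F P where
  carrier := {c | c ∈ C ∧ ∃ k : ℕ, (LinearMap.mulLeft F a ^ k) c = 0}
  zero_mem' := ⟨zero_mem _, 0, map_zero _⟩
  add_mem' := by
    rintro x y ⟨hx, k, hk⟩ ⟨hy, l, hl⟩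
    refine ⟨add_mem hx hy, max k l, ?_⟩
    rw [map_add, Module.End.pow_map_zero_of_le (le_max_left k l) hk,
      Module.End.pow_map_zero_of_le (le_max_right k l) hl, add_zero]
  smul_mem' := by
    rintro r x ⟨hx, k, hk⟩
    exact ⟨Submodule.smul_mem _ _ hx, k, by rw [map_smul, hk, smul_zero]⟩

theorem pow_mulLeft_mem [SMulCommClass F P P] {W : Submodule F P} {a : P}
    (hW : ∀ w ∈ W, a * w ∈ W) (k : ℕ) {w : P} (hw : w ∈ W) :
    (LinearMap.mulLeft F a ^ k) w ∈ W := by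
  induction k with
  | zero => simpa using hw
  | succ k ih =>
    rw [pow_succ', Module.End.mul_apply]
    exact hW _ ih

section KerSq

variable [SMulCommClass F P P] {C A : Submodule F P}

/-- The kernel of the square of left multiplication by `a`. -/
def kerSq (a : P) : Submodule F P := LinearMap.ker (LinearMap.mulLeft F a ^ 2)

theorem mem_kerSq {a x : P} : x ∈ kerSq (F := F) a ↔ a * (a * x) = 0 := by
  simp [kerSq, pow_two]

theorem disjoint_kerSq (hC : IsIdeal C) {a : P} (hinj : ∀ c ∈ C, a * c = 0 → c = 0) :
    Disjoint (kerSq a) C := by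
  rw [Submodule.disjoint_def]
  intro x hx hxC
  rw [mem_kerSq] at hx
  exact hinj x hxC (hinj _ (hC a x hxC).1 hx)

theorem exists_mul_eq [FiniteDimensional F P] (hC : IsIdeal C) {a : P}
    (hinj : ∀ c ∈ C, a * c = 0 → c = 0) {d : P} (hd : d ∈ C) : ∃ c ∈ C, a * c = d := by
  let f : C →ₗ[F] C := (LinearMap.mulLeft F a).restrict fun c hc => (hC a c hc).1
  have hf : Function.Injective f := by
    rw [injective_iff_map_eq_zero]
    intro c h
    exact Subtype.ext (hinj c c.2 (congrArg Subtype.val h))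
  obtain ⟨c, hc⟩ := LinearMap.surjective_of_injective hf ⟨d, hd⟩
  exact ⟨c, c.2, congrArg Subtype.val hc⟩

theorem map_kerSq {f : P →ₗ[F] P} (hf : IsAutomorphism f) (u : P) :
    (kerSq u).map f = kerSq (f u) := by
  ext y
  obtain ⟨x, rfl⟩ := hf.1.2 y
  rw [Submodule.mem_map]
  simp only [hf.1.1.eq_iff, exists_eq_right]
  rw [mem_kerSq, mem_kerSq, ← hf.2, ← hf.2, map_eq_zero_iff f hf.1.1]

theorem isCompl_kerSq [FiniteDimensional F P] (hC : IsIdeal C) (hA : IsIdeal A)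
    (hAA : ∀ a ∈ A, ∀ b ∈ A, a * b ∈ C) {a : P} (ha : a ∈ A)
    (hinj : ∀ c ∈ C, a * c = 0 → c = 0) : IsCompl (kerSq a) C := by
  refine ⟨disjoint_kerSq hC hinj, codisjoint_iff.2 (eq_top_iff.2 fun x _ => ?_)⟩
  obtain ⟨c, hc, hac⟩ := exists_mul_eq hC hinj (hAA a ha _ (hA x a ha).2)
  obtain ⟨d, hd, had⟩ := exists_mul_eq hC hinj hc
  refine Submodule.mem_sup.2 ⟨x - d, ?_, d, hd, sub_add_cancel x d⟩
  rw [mem_kerSq, mul_sub, mul_sub, had, hac, sub_self]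

theorem mul_mem_kerSq (hL : IsLeibniz P) (hA : IsIdeal A)
    (hAA : ∀ a ∈ A, ∀ b ∈ A, a * b ∈ C) {a : P} (ha : a ∈ A)
    (hinj : ∀ c ∈ C, a * c = 0 → c = 0) {x y : P} (hx : x ∈ kerSq (F := F) a)
    (hy : y ∈ kerSq (F := F) a) : x * y ∈ kerSq (F := F) a := by
  rw [mem_kerSq] at *
  have hxy : (a * x) * (a * y) = 0 := by
    refine hinj _ (hAA _ (hA x a ha).2 _ (hA y a ha).2) ?_
    rw [hL, hx, hy, zero_mul, mul_zero, add_zero]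
  rw [hL a x y, mul_add, hL a (a * x) y, hL a x (a * y), hx, hy, hxy, zero_mul, mul_zero]
  simp

theorem exists_isComplement [FiniteDimensional F P] (hL : IsLeibniz P) (hC : IsIdeal C)
    (hA : IsIdeal A) (hAA : ∀ a ∈ A, ∀ b ∈ A, a * b ∈ C) {a : P} (ha : a ∈ A)
    (hinj : ∀ c ∈ C, a * c = 0 → c = 0) : ∃ U : NonUnitalSubalgebra F P, IsComplement C U :=
  ⟨{ kerSq (F := F) a with mul_mem' := mul_mem_kerSq hL hA hAA ha hinj },
    isCompl_kerSq hC hA hAA ha hinj⟩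

end KerSq

section AbelianSection

variable [IsScalarTower F P P] [SMulCommClass F P P] {C A : Submodule F P}

theorem mul_left_comm_of_mul_mem (hL : IsLeibniz P) (hCC : centraliser C = C)
    (hAA : ∀ a ∈ A, ∀ b ∈ A, a * b ∈ C) {a b c : P} (ha : a ∈ A) (hb : b ∈ A) (hc : c ∈ C) :
    a * (b * c) = b * (a * c) := by
  rw [hL a b c, mul_eq_zero_of_centraliser hCC (hAA a ha b hb) hc, zero_add]

theorem pow_mulLeft_mul_of_mul_mem (hL : IsLeibniz P) (hC : IsIdeal C)
    (hCC : centraliser C = C) (hAA : ∀ a ∈ A, ∀ b ∈ A, a * b ∈ C) {a b c : P}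
    (ha : a ∈ A) (hb : b ∈ A) (hc : c ∈ C) (k : ℕ) :
    (LinearMap.mulLeft F a ^ k) (b * c) = b * (LinearMap.mulLeft F a ^ k) c := by
  induction k with
  | zero => simp
  | succ k ih =>
    rw [pow_succ', Module.End.mul_apply, Module.End.mul_apply, ih, LinearMap.mulLeft_apply,
      LinearMap.mulLeft_apply]
    exact mul_left_comm_of_mul_mem hL hCC hAA ha hb
      (pow_mulLeft_mem (fun w hw => (hC a w hw).1) k hc)

theorem pow_succ_mulLeft_mul_eq_zero (hL : IsLeibniz P) (hC : IsIdeal C)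
    (hCC : centraliser C = C) (hA : IsIdeal A) (hAA : ∀ a ∈ A, ∀ b ∈ A, a * b ∈ C) {a : P}
    (ha : a ∈ A) (x : P) (k : ℕ) : ∀ c ∈ C, (LinearMap.mulLeft F a ^ k) c = 0 →
      (LinearMap.mulLeft F a ^ (k + 1)) (x * c) = 0 := by
  induction k with
  | zero =>
    intro c _ h
    have h0 : c = 0 := by simpa using h
    simp [h0]
  | succ k ih =>
    intro c hc h
    have h2 : (LinearMap.mulLeft F a ^ k) (a * c) = 0 := by
      simpa [pow_succ] using h
    rw [pow_succ _ (k + 1), Module.End.mul_apply, LinearMap.mulLeft_apply, hL, map_add,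
      pow_mulLeft_mul_of_mul_mem hL hC hCC hAA ha (hA x a ha).2 hc, h, mul_zero, zero_add]
    exact ih _ (hC a c hc).1 h2

theorem isIdeal_fittingNull (hL : IsLeibniz P) (hC : IsMinimalIdeal C)
    (hCC : centraliser C = C) (hA : IsIdeal A) (hAA : ∀ a ∈ A, ∀ b ∈ A, a * b ∈ C) {a : P}
    (ha : a ∈ A) : IsIdeal (fittingNull C a) := by
  refine hC.isIdeal_of_mul_left_mem hL hCC (fun c hc => hc.1) ?_
  rintro x c ⟨hc, k, hk⟩
  exact ⟨(hC.isIdeal x c hc).1, k + 1,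
    pow_succ_mulLeft_mul_eq_zero hL hC.isIdeal hCC hA hAA ha x k c hc hk⟩

/-- If every element of `A` acts nilpotently on `C`, then `A` annihilates a nonzero element. -/
theorem exists_mul_eq_zero_of_nilpotent [FiniteDimensional F P] (hL : IsLeibniz P)
    (hC : IsMinimalIdeal C) (hCC : centraliser C = C)
    (hAA : ∀ a ∈ A, ∀ b ∈ A, a * b ∈ C) (hnil : ∀ a ∈ A, C ≤ fittingNull C a) :
    ∃ c ∈ C, c ≠ 0 ∧ ∀ a ∈ A, a * c = 0 := by
  obtain ⟨W, ⟨hW0, hWC, hWA⟩, hmin⟩ := exists_minimal_of_wellFoundedLT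
    (fun W : Submodule F P => W ≠ ⊥ ∧ W ≤ C ∧ ∀ a ∈ A, ∀ w ∈ W, a * w ∈ W)
    ⟨C, hC.ne_bot, le_rfl, fun a _ w hw => (hC.isIdeal a w hw).1⟩
  obtain ⟨w, hw, hw0⟩ := W.ne_bot_iff.1 hW0
  refine ⟨w, hWC hw, hw0, fun a ha => ?_⟩
  have hle : W ≤ W ⊓ LinearMap.ker (LinearMap.mulLeft F a) := by
    refine hmin ⟨?_, inf_le_left.trans hWC, ?_⟩ inf_le_left
    · have hex : ∃ k : ℕ, (LinearMap.mulLeft F a ^ k) w = 0 := (hnil a ha (hWC hw)).2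
      classical
      obtain ⟨m, hm⟩ : ∃ m, Nat.find hex = m + 1 := by
        refine Nat.exists_eq_succ_of_ne_zero fun h => hw0 ?_
        have := Nat.find_spec hex
        rw [h] at this
        simpa using this
      refine (Submodule.ne_bot_iff _).2 ⟨(LinearMap.mulLeft F a ^ m) w,
        ⟨pow_mulLeft_mem (hWA a ha) m hw, ?_⟩, Nat.find_min hex (by omega)⟩
      have := Nat.find_spec hex
      rw [hm, pow_succ', Module.End.mul_apply] at this
      exact this
    · intro b hb v hv
      refine ⟨hWA b hb v hv.1, ?_⟩
      have hav : a * v = 0 := hv.2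
      change a * (b * v) = 0
      rw [mul_left_comm_of_mul_mem hL hCC hAA ha hb (hWC hv.1), hav, mul_zero]
  exact (hle hw).2

/-- An ideal `A` not contained in `C` with `A * A ⊆ C` contains an element acting injectively
on `C`. -/
theorem exists_mul_left_injective [FiniteDimensional F P] (hL : IsLeibniz P)
    (hC : IsMinimalIdeal C) (hCC : centraliser C = C) (hA : IsIdeal A) (hAC : ¬ A ≤ C)
    (hAA : ∀ a ∈ A, ∀ b ∈ A, a * b ∈ C) :
    ∃ a ∈ A, ∀ c ∈ C, a * c = 0 → c = 0 := by
  by_contra! hcon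
  have hnil : ∀ a ∈ A, C ≤ fittingNull C a := by
    intro a ha
    obtain ⟨c, hc, hac, hc0⟩ := hcon a ha
    refine hC.le_of_centraliser hCC (isIdeal_fittingNull hL hC hCC hA hAA ha)
      ((Submodule.ne_bot_iff _).2 ⟨c, ⟨hc, 1, ?_⟩, hc0⟩)
    simpa using hac
  obtain ⟨c, hc, hc0, hAc⟩ := exists_mul_eq_zero_of_nilpotent hL hC hCC hAA hnil
  let Z : Submodule F P := C ⊓ ⨅ a ∈ A, LinearMap.ker (LinearMap.mulLeft F a)
  have hZ : ∀ z, z ∈ Z ↔ z ∈ C ∧ ∀ a ∈ A, a * z = 0 := by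
    intro z
    simp [Z]
  have hZI : IsIdeal Z := by
    refine hC.isIdeal_of_mul_left_mem hL hCC inf_le_left fun x z hz => ?_
    rw [hZ] at hz ⊢
    refine ⟨(hC.isIdeal x z hz.1).1, fun a ha => ?_⟩
    rw [hL, hz.2 _ (hA x a ha).2, hz.2 a ha, mul_zero, add_zero]
  have hCZ : C ≤ Z :=
    hC.le_of_centraliser hCC hZI ((Submodule.ne_bot_iff _).2 ⟨c, (hZ c).2 ⟨hc, hAc⟩, hc0⟩)
  refine hAC fun a ha => ?_
  rw [← hCC]
  intro d hd
  have had := ((hZ d).1 (hCZ hd)).2 a ha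
  refine ⟨had, ?_⟩
  rcases hC.mul_eq_zero_or_sq_eq_zero hL hCC with h | h
  · exact h d hd a
  · rw [mul_eq_neg_mul h, had, neg_zero]

/-- In a soluble algebra, an ideal other than the whole algebra admits an ideal not contained in
it whose products all lie in it. -/
theorem IsSoluble.exists_isIdeal_mul_mem [FiniteDimensional F P] (hL : IsLeibniz P)
    (hS : IsSoluble F P) (hC : C ≠ ⊤) :
    ∃ A : Submodule F P, IsIdeal A ∧ ¬ A ≤ C ∧ ∀ a ∈ A, ∀ b ∈ A, a * b ∈ C := by
  obtain ⟨A, ⟨hA, hAC⟩, hmin⟩ := exists_minimal_of_wellFoundedLT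
    (fun A : Submodule F P => IsIdeal A ∧ ¬ A ≤ C)
    ⟨⊤, fun _ _ _ => ⟨trivial, trivial⟩, fun h => hC (top_le_iff.1 h)⟩
  refine ⟨A, hA, hAC, ?_⟩
  by_contra! hcon
  obtain ⟨a, ha, b, hb, hab⟩ := hcon
  have hle : A ≤ Submodule.span F {z | ∃ x ∈ A, ∃ y ∈ A, x * y = z} := by
    refine hmin ⟨hA.span_mul hL, fun h => hab (h (Submodule.subset_span ⟨a, ha, b, hb, rfl⟩))⟩ ?_
    refine Submodule.span_le.2 ?_
    rintro _ ⟨x, _, y, hy, rfl⟩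
    exact (hA x y hy).1
  obtain ⟨n, S, h0, hn, hstep⟩ := hS
  have hAS : ∀ i ≤ n, A ≤ (S i).toSubmodule := by
    intro i
    induction i with
    | zero => intro _ x _; simp [h0]
    | succ i ih =>
      intro hi
      refine hle.trans (Submodule.span_le.2 ?_)
      rintro _ ⟨x, hx, y, hy, rfl⟩
      exact (hstep i hi).2.2 x (ih (by omega) hx) y (ih (by omega) hy)
  refine hAC fun x hx => ?_
  have : x ∈ S n := hAS n le_rfl hx
  rw [hn, NonUnitalAlgebra.mem_bot] at this
  rw [this]
  exact zero_mem _

theorem isAutomorphism_onePlusLeft (hL : IsLeibniz P) (hC : IsIdeal C)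
    (hCC : centraliser C = C) {c : P} (hc : c ∈ C) : IsAutomorphism (onePlusLeft F c) := by
  have hcc : ∀ x, c * (c * x) = 0 := fun x =>
    mul_eq_zero_of_centraliser hCC hc (hC x c hc).2
  refine ⟨⟨fun x y hxy => ?_, fun y => ⟨y - c * y, ?_⟩⟩, fun x y => ?_⟩
  · have h : x + c * x = y + c * y := hxy
    have h2 : c * x = c * y := by
      have := congrArg (c * ·) h
      simpa only [mul_add, hcc, add_zero] using this
    rw [h2] at h
    exact add_right_cancel h
  · change y - c * y + c * (y - c * y) = y
    rw [mul_sub, hcc, sub_zero, sub_add_cancel]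
  · change x * y + c * (x * y) = (x + c * x) * (y + c * y)
    rw [hL, add_mul, mul_add, mul_add,
      mul_eq_zero_of_centraliser hCC (hC x c hc).2 (hC y c hc).2, add_zero]
    abel

/-- Each complement is the kernel of `L_u ^ 2` for some element `u` congruent to `a` modulo `C`. -/
theorem IsComplement.exists_eq_kerSq [FiniteDimensional F P] (hC : IsIdeal C)
    (hCC : centraliser C = C) (hA : IsIdeal A) (hCA : C ≤ A)
    (hAA : ∀ a ∈ A, ∀ b ∈ A, a * b ∈ C) {a : P} (ha : a ∈ A)
    (hinj : ∀ c ∈ C, a * c = 0 → c = 0) {U : NonUnitalSubalgebra F P} (hU : IsComplement C U) :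
    ∃ u ∈ A, u - a ∈ C ∧ (∀ c ∈ C, u * c = 0 → c = 0) ∧ U.toSubmodule = kerSq u := by
  obtain ⟨u, hu, c, hc, huc⟩ := Submodule.mem_sup.1
    (show a ∈ U.toSubmodule ⊔ C from hU.sup_eq_top ▸ Submodule.mem_top)
  have huA : u ∈ A := by
    rw [eq_sub_of_add_eq huc]
    exact sub_mem ha (hCA hc)
  have hinju : ∀ d ∈ C, u * d = 0 → d = 0 := by
    intro d hd h
    refine hinj d hd ?_
    rw [← huc, add_mul, h, mul_eq_zero_of_centraliser hCC hc hd, add_zero]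
  refine ⟨u, huA, ?_, hinju, ?_⟩
  · rw [← huc, sub_add_cancel_left]
    exact neg_mem hc
  · refine (eq_of_le_of_inf_le_of_sup_le (z := C) (fun x hx => ?_) ?_ ?_)
    · rw [mem_kerSq]
      exact Submodule.disjoint_def.1 hU.disjoint _ (U.mul_mem hu (U.mul_mem hu hx))
        (hAA u huA _ (hA x u huA).2)
    · rw [(disjoint_kerSq hC hinju).eq_bot]
      exact bot_le
    · rw [hU.sup_eq_top]
      exact le_top

end AbelianSection

end

end LeibnizAlg

open LeibnizAlg in
theorem mainTheorem2 {F P : Type*} [Field F] [NonUnitalNonAssocRing P] [Module F P]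
    [IsScalarTower F P P] [SMulCommClass F P P] [FiniteDimensional F P]
    (hL : LeibnizAlg.IsLeibniz P) (hP : LeibnizAlg.IsPrimitive F P)
    (C : Submodule F P) (hC : C = LeibnizAlg.socle F P) :
    -- `C` is the unique minimal ideal, and it is its own centraliser
    (∀ I : Submodule F P, LeibnizAlg.IsMinimalIdeal I ↔ I = C) ∧
    LeibnizAlg.centraliser C = C ∧
    -- `P` splits over `C`
    (∃ U : NonUnitalSubalgebra F P, LeibnizAlg.IsComplement C U) ∧
    -- the maps `1 + L_c` with `c ∈ C` are automorphisms, and conjugate any two complements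
    (∀ c ∈ C, LeibnizAlg.IsAutomorphism (LeibnizAlg.onePlusLeft F c)) ∧
    (∀ U V : NonUnitalSubalgebra F P, LeibnizAlg.IsComplement C U →
      LeibnizAlg.IsComplement C V → LeibnizAlg.IsConjugate C U V) ∧
    -- if `P` is not a Lie algebra, there is exactly one complement
    (¬ LeibnizAlg.IsLie P → ∃! U : NonUnitalSubalgebra F P, LeibnizAlg.IsComplement C U) := by
  obtain ⟨hS, C', hmin, hCC⟩ := hP
  rw [hmin.socle_eq hCC] at hC
  subst hC
  have hCI := hmin.isIdeal
  have hex : ∃ U : NonUnitalSubalgebra F P, IsComplement C U := by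
    by_cases htop : C = ⊤
    · refine ⟨⊥, ?_⟩
      rw [IsComplement, htop, NonUnitalAlgebra.toSubmodule_bot]
      exact isCompl_bot_top
    · obtain ⟨A, hA, hAC, hAA⟩ := hS.exists_isIdeal_mul_mem hL htop
      obtain ⟨a, ha, hinj⟩ := exists_mul_left_injective hL hmin hCC hA hAC hAA
      exact exists_isComplement hL hCI hA hAA ha hinj
  have hid : onePlusLeft F (0 : P) = LinearMap.id := by
    ext x
    simp [onePlusLeft]
  have hconj : ∀ U V : NonUnitalSubalgebra F P, IsComplement C U → IsComplement C V →
      IsConjugate C U V ∧ ((∀ c ∈ C, ∀ x, c * x = 0) → V = U) := by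
    intro U V hU hV
    suffices h : IsConjugate C U V by
      refine ⟨h, fun h0 => ?_⟩
      obtain ⟨c, hc, hVU⟩ := h
      have : onePlusLeft F c = LinearMap.id := by
        ext x
        simp [onePlusLeft, h0 c hc]
      rw [this, Submodule.map_id] at hVU
      exact NonUnitalSubalgebra.toSubmodule_injective hVU
    by_cases htop : C = ⊤
    · refine ⟨0, zero_mem _, ?_⟩
      rw [hid, Submodule.map_id]
      rw [IsComplement, htop] at hU hV
      rw [disjoint_top.1 hU.disjoint, disjoint_top.1 hV.disjoint]
    · obtain ⟨A, hA, hAC, hAA⟩ := hS.exists_isIdeal_mul_mem hL htop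
      obtain ⟨a, ha, hinj⟩ := exists_mul_left_injective hL hmin hCC hA hAC hAA
      have hCA : C ≤ A :=
        hmin.le_of_centraliser hCC hA fun h => hAC (h ▸ bot_le)
      obtain ⟨u, huA, hua, hinju, hUk⟩ := hU.exists_eq_kerSq hCI hCC hA hCA hAA ha hinj
      obtain ⟨v, hvA, hva, hinjv, hVk⟩ := hV.exists_eq_kerSq hCI hCC hA hCA hAA ha hinj
      have hvu : v - u ∈ C := by
        rw [← sub_sub_sub_cancel_right v u a]
        exact sub_mem hva hua
      rcases hmin.mul_eq_zero_or_sq_eq_zero hL hCC with h | h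
      · refine ⟨0, zero_mem _, ?_⟩
        have hmul : ∀ x, v * x = u * x := fun x =>
          sub_eq_zero.1 (by rw [← sub_mul]; exact h _ hvu x)
        rw [hid, Submodule.map_id, hUk, hVk]
        ext x
        rw [mem_kerSq, mem_kerSq, hmul, hmul]
      · obtain ⟨c, hc, hcu⟩ := exists_mul_eq hCI hinju (neg_mem hvu)
        refine ⟨c, hc, ?_⟩
        rw [hUk, hVk, map_kerSq (isAutomorphism_onePlusLeft hL hCI hCC hc)]
        congr 1
        change v = u + c * u
        rw [mul_eq_neg_mul h, hcu, neg_neg, add_sub_cancel]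
  refine ⟨hmin.iff_eq_of_centraliser hCC, hCC, hex,
    fun c hc => isAutomorphism_onePlusLeft hL hCI hCC hc,
    fun U V hU hV => (hconj U V hU hV).1, fun hnot => ?_⟩
  obtain ⟨U, hU⟩ := hex
  refine ⟨U, hU, fun V hV => (hconj U V hU hV).2 ?_⟩
  exact (hmin.mul_eq_zero_or_sq_eq_zero hL hCC).resolve_right
    fun h => hnot (isLie_of_sq_eq_zero hL h)
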